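/- Let $M$ be a lattice of rank $d$ and let $\Lambda\subset M$ be a finitely generated subsemigroup (with $0$) which generates $M$ as a group and such that the cone $\sigma^\vee=\mathbf R_{\ge 0}\Lambda\subset M_{\mathbf R}$ is strictly convex. Let $e_1,\dots,e_n$ be the minimal system of generators of $\Lambda$, $N$ the dual lattice of $M$, $\sigma\subset N_{\mathbf R}$ the dual cone of $\sigma^\vee$, and $Z^\Lambda=\operatorname{Spec}\mathbf C[\Lambda]$, with distinguished point $0$ defined by the ideal $(X^u)_{0\ne u\in\Lambda}$. For $1\le k\le d$ let $\mathcal J_k=\{e_{i_1}+\cdots+e_{i_k}\mid i_1<\cdots<i_k,\ e_{i_1}\wedge\cdots\wedge e_{i_k}\neq 0\}$, let $\mathcal N(\mathcal J_k)$ be the convex hull of $\mathcal J_k+\sigma^\vee$, and for $\nu\in\sigma$ put $\operatorname{ord}_{\mathcal J_k}(\nu)=\inf_{w\in\mathcal N(\mathcal J_k)}\langle\nu,w\rangle$ and $\mathcal F_\nu=\{w\in\mathcal N(\mathcal J_k)\mid\langle\nu,w\rangle=\operatorname{ord}_{\mathcal J_k}(\nu)\}$ (the face of $\mathcal N(\mathcal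 J_k)$ determined by $\nu$). Put $\phi_1=\operatorname{ord}_{\mathcal J_1}$, $\phi_k=\operatorname{ord}_{\mathcal J_k}-\operatorname{ord}_{\mathcal J_{k-1}}$ for $2\le k\le d$, $\phi_{d+1}=+\infty$, and $$A_k=\{(\nu,s)\mid \nu\in\operatorname{int}(\sigma)\cap N,\ s\in\mathbf Z_{\ge 0},\ \phi_k(\nu)\le s<\phi_{k+1}(\nu)\}.$$ Let $H_\Lambda$ be the set of arcs $\operatorname{Spec}\mathbf C[[t]]\to Z^\Lambda$ with origin at $0$, let $H^*_\Lambda\subset H_\Lambda$ be the set of those whose generic point lies in the torus, and for $\nu\in\operatorname{int}(\sigma)\cap N$ let $H^*_{\Lambda,\nu}$ be the set of $h\in H^*_\Lambda$ with $\operatorname{ord}_t(X^u\circ h)=\langle\nu,u\rangle$ for all $u\in\Lambda$. For a face $\theta$ of $\sigma$ let $H_{\Lambda\cap\theta^\perp}\subset H_\Lambda$ be the set of arcs with origin at $0$ that factor through the orbit closure $Z^{\Lambda\cap\theta^\perp}\subset Z^\Lambda$. Let $j_s$ send an arc to its $s$-jet, that is, its reduction modulo $t^{s+1}$. **Proposition.**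 If $1\le k\le d$ and $(\nu,s)\in A_k$, then the following are equivalent: (i) $\displaystyle j_s(H^*_{\Lambda,\nu})\cap\bigcup_{0\ne\theta\le\sigma}j_s(H_{\Lambda\cap\theta^\perp})=\emptyset$; (ii) the face $\mathcal F_\nu$ of $\mathcal N(\mathcal J_k)$ determined by $\nu$ is contained in the interior of $\sigma^\vee$. -/

import Mathlib

/-!
Throughout, `E` is the real vector space `M_ℝ` spanned by a lattice `M`, the dual space
`N_ℝ` is `StrongDual ℝ E`, and `Λ` is an additive submonoid of `E`.
-/

namespace ToricArcs

open scoped Pointwise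

noncomputable section

section Cones

variable {E : Type*} [NormedAddCommGroup E] [NormedSpace ℝ E]

/-- `e 0, …, e (n - 1)` is a minimal system of generators of the semigroup `Λ`, listed without
repetition. -/
def IsMinimalGenerators (Λ : AddSubmonoid E) {n : ℕ} (e : Fin n → E) : Prop :=
  Function.Injective e ∧ AddSubmonoid.closure (Set.range e) = Λ ∧
    ∀ S : Set E, S ⊂ Set.range e → AddSubmonoid.closure S ≠ Λ

/-- The cone `σ^∨ = ℝ_{≥ 0} Λ` in `M_ℝ`. -/
def sigmaDual (Λ : AddSubmonoid E) : PointedCone ℝ E :=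
  PointedCone.hull ℝ (Λ : Set E)

/-- The cone `σ` in `N_ℝ`, dual to `σ^∨`. -/
def sigma (Λ : AddSubmonoid E) : Set (StrongDual ℝ E) :=
  {ν | ∀ w ∈ sigmaDual Λ, 0 ≤ ν w}

/-- `θ` is a face of the cone `σ`: it is cut out in `σ` by an element of the dual cone
(`σ` itself is a face). -/
def IsFace (Λ : AddSubmonoid E) (θ : Set (StrongDual ℝ E)) : Prop :=
  ∃ w ∈ sigmaDual Λ, θ = {ν ∈ sigma Λ | ν w = 0}

/-- The lattice `N` dual to `M`, inside `N_ℝ`. -/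
def dualLattice (M : Submodule ℤ E) : Set (StrongDual ℝ E) :=
  {ν | ∀ m ∈ M, ∃ z : ℤ, ν m = z}

/-- The set `𝒥_k` of the exponents that generate the `k`-th logarithmic jacobian ideal: the sums
`e_{i_1} + ⋯ + e_{i_k}` with `i_1 < ⋯ < i_k` and `e_{i_1} ∧ ⋯ ∧ e_{i_k} ≠ 0`. -/
def logJacobian {n : ℕ} (e : Fin n → E) (k : ℕ) : Set E :=
  {w | ∃ i : Fin k → Fin n, StrictMono i ∧
    ExteriorAlgebra.ιMulti ℝ k (fun r => e (i r)) ≠ 0 ∧ w = ∑ r, e (i r)}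

/-- The Newton polyhedron `𝒩(I)` of a set `I` of exponents: the convex hull of `I + σ^∨`. -/
def newtonPolyhedron (Λ : AddSubmonoid E) (I : Set E) : Set E :=
  convexHull ℝ (I + (sigmaDual Λ : Set E))

/-- The support function `ord_I(ν) = inf {⟨ν, w⟩ : w ∈ 𝒩(I)}` of the Newton polyhedron. The
infimum is taken of a nonempty set that is bounded below when `I ⊆ Λ` is nonempty and `ν ∈ σ`. -/
def ordFun (Λ : AddSubmonoid E) (I : Set E) (ν : StrongDual ℝ E) : ℝ :=
  sInf ((fun w => ν w) '' newtonPolyhedron Λ I)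

/-- The face of the Newton polyhedron `𝒩(I)` determined by `ν`. -/
def newtonFace (Λ : AddSubmonoid E) (I : Set E) (ν : StrongDual ℝ E) : Set E :=
  {w ∈ newtonPolyhedron Λ I | ν w = ordFun Λ I ν}

/-- The functions `φ_0 = 0`, `φ_1 = ord_{𝒥_1}`, `φ_k = ord_{𝒥_k} - ord_{𝒥_{k-1}}` for
`2 ≤ k ≤ d`, and `φ_{d+1} = +∞`, where `d = dim M_ℝ`. -/
def phi (Λ : AddSubmonoid E) {n : ℕ} (e : Fin n → E) (k : ℕ) (ν : StrongDual ℝ E) : EReal :=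
  if k = 0 then 0
  else if Module.finrank ℝ E < k then ⊤
  else if k = 1 then ((ordFun Λ (logJacobian e 1) ν : ℝ) : EReal)
  else ((ordFun Λ (logJacobian e k) ν - ordFun Λ (logJacobian e (k - 1)) ν : ℝ) : EReal)

/-- The set `A_k` of the pairs `(ν, s)` with `ν ∈ int(σ) ∩ N` and `φ_k(ν) ≤ s < φ_{k+1}(ν)`. -/
def setA (M : Submodule ℤ E) (Λ : AddSubmonoid E) {n : ℕ} (e : Fin n → E) (k : ℕ) :
    Set (StrongDual ℝ E × ℕ) :=
  {p | p.1 ∈ interior (sigma Λ) ∧ p.1 ∈ dualLattice M ∧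
    phi Λ e k p.1 ≤ ((p.2 : ℝ) : EReal) ∧ ((p.2 : ℝ) : EReal) < phi Λ e (k + 1) p.1}

/-- The semigroup `Λ ∩ θ^⊥`. -/
def orthSemigroup (Λ : AddSubmonoid E) (θ : Set (StrongDual ℝ E)) : AddSubmonoid E where
  carrier := {u | u ∈ Λ ∧ ∀ ν ∈ θ, ν u = 0}
  zero_mem' := ⟨Λ.zero_mem, fun ν _ => map_zero ν⟩
  add_mem' := fun {a b} ha hb =>
    ⟨Λ.add_mem ha.1 hb.1, fun ν hν => by rw [map_add, ha.2 ν hν, hb.2 ν hν, add_zero]⟩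

/-- If `θ ⊆ σ` then a sum of two elements of `Λ` lies in `θ^⊥` only if both of them do. -/
theorem add_mem_orthSemigroup_iff {Λ : AddSubmonoid E} {θ : Set (StrongDual ℝ E)}
    (hθ : θ ⊆ sigma Λ) (a b : Λ) :
    ((a + b : Λ) : E) ∈ orthSemigroup Λ θ ↔
      (a : E) ∈ orthSemigroup Λ θ ∧ (b : E) ∈ orthSemigroup Λ θ := by
  constructor
  · intro h
    have key : ∀ ν ∈ θ, ν (a : E) = 0 ∧ ν (b : E) = 0 := by
      intro ν hν
      have h0 : ν (a : E) + ν (b : E) = 0 := by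
        have := h.2 ν hν
        rwa [AddSubmonoid.coe_add, map_add] at this
      have ha : 0 ≤ ν (a : E) := hθ hν _ (PointedCone.subset_hull a.2)
      have hb : 0 ≤ ν (b : E) := hθ hν _ (PointedCone.subset_hull b.2)
      constructor <;> linarith
    exact ⟨⟨a.2, fun ν hν => (key ν hν).1⟩, ⟨b.2, fun ν hν => (key ν hν).2⟩⟩
  · rintro ⟨ha, hb⟩
    exact (orthSemigroup Λ θ).add_mem ha hb

theorem IsFace.subset_sigma {Λ : AddSubmonoid E} {θ : Set (StrongDual ℝ E)}
    (h : IsFace Λ θ) : θ ⊆ sigma Λ := by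
  obtain ⟨w, -, rfl⟩ := h
  exact fun ν hν => hν.1

end Cones

section Arcs

variable {E : Type*} [NormedAddCommGroup E] [NormedSpace ℝ E]

/-- The arcs on the affine toric variety `Z^Λ = Spec ℂ[Λ]`, that is the morphisms
`Spec ℂ[[t]] → Z^Λ`, given by the homomorphisms of `ℂ`-algebras `ℂ[Λ] → ℂ[[t]]`. -/
abbrev Arc (Λ : AddSubmonoid E) : Type _ :=
  AddMonoidAlgebra ℂ Λ →ₐ[ℂ] PowerSeries ℂ

/-- The `s`-jets on `Z^Λ`, that is the morphisms `Spec ℂ[t]/(t^{s+1}) → Z^Λ`. -/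
abbrev Jet (Λ : AddSubmonoid E) (s : ℕ) : Type _ :=
  AddMonoidAlgebra ℂ Λ →ₐ[ℂ]
    (PowerSeries ℂ ⧸ Ideal.span {(PowerSeries.X : PowerSeries ℂ) ^ (s + 1)})

/-- The truncation `j_s`, which sends an arc to its `s`-jet. -/
def jet {Λ : AddSubmonoid E} (s : ℕ) (h : Arc Λ) : Jet Λ s :=
  (Ideal.Quotient.mkₐ ℂ (Ideal.span {(PowerSeries.X : PowerSeries ℂ) ^ (s + 1)})).comp h

/-- The power series `X^u ∘ h`, for `u ∈ Λ` and an arc `h`. -/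
def coord {Λ : AddSubmonoid E} (h : Arc Λ) (u : Λ) : PowerSeries ℂ :=
  h (AddMonoidAlgebra.single u 1)

/-- The set `H_Λ` of the arcs on `Z^Λ` whose origin is the distinguished point `0`, which is
defined by the ideal generated by the `X^u` with `0 ≠ u ∈ Λ`. -/
def arcsAtOrigin (Λ : AddSubmonoid E) : Set (Arc Λ) :=
  {h | ∀ u : Λ, u ≠ 0 → PowerSeries.constantCoeff (coord h u) = 0}

/-- The set `H_Λ^*` of the arcs in `H_Λ` with generic point in the torus: all the
`X^u ∘ h` are non-zero. -/
def torusArcs (Λ : AddSubmonoid E) : Set (Arc Λ) :=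
  {h ∈ arcsAtOrigin Λ | ∀ u : Λ, coord h u ≠ 0}

/-- The orbit `H_{Λ,ν}^*` of the arcs `h ∈ H_Λ^*` with `ν_h = ν`: the order of vanishing of
`X^u ∘ h` at `t = 0` is `⟨ν, u⟩`, for all `u ∈ Λ`. -/
def orbit (Λ : AddSubmonoid E) (ν : StrongDual ℝ E) : Set (Arc Λ) :=
  {h ∈ torusArcs Λ | ∀ u : Λ, ((coord h u).order.toNat : ℝ) = ν (u : E)}

open Classical in
/-- The surjection `ℂ[Λ] → ℂ[Λ ∩ θ^⊥]` that defines the closed embedding of the orbit closure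
`Z^{Λ ∩ θ^⊥}` in `Z^Λ`: it sends `X^u` to `X^u` if `u ∈ θ^⊥` and to `0` otherwise. -/
def orbitClosureHom (Λ : AddSubmonoid E) (θ : Set (StrongDual ℝ E)) (hθ : θ ⊆ sigma Λ) :
    AddMonoidAlgebra ℂ Λ →ₐ[ℂ] AddMonoidAlgebra ℂ (orthSemigroup Λ θ) :=
  AddMonoidAlgebra.lift ℂ (AddMonoidAlgebra ℂ (orthSemigroup Λ θ)) Λ
    { toFun := fun u =>
        if h : (u.toAdd : E) ∈ orthSemigroup Λ θ then
          AddMonoidAlgebra.single ⟨(u.toAdd : E), h⟩ 1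
        else 0
      map_one' := by
        have h0 : ((Multiplicative.toAdd (1 : Multiplicative Λ) : Λ) : E) ∈
            orthSemigroup Λ θ := (orthSemigroup Λ θ).zero_mem
        rw [dif_pos h0]
        rfl
      map_mul' := by
        intro u v
        have key := add_mem_orthSemigroup_iff hθ u.toAdd v.toAdd
        have huv : ((u * v).toAdd : Λ) = u.toAdd + v.toAdd := rfl
        by_cases hu : (u.toAdd : E) ∈ orthSemigroup Λ θ
        · by_cases hv : (v.toAdd : E) ∈ orthSemigroup Λ θ
          · rw [dif_pos hu, dif_pos hv, dif_pos (by rw [huv]; exact key.2 ⟨hu, hv⟩),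
              AddMonoidAlgebra.single_mul_single, one_mul]
            rfl
          · rw [dif_neg hv, mul_zero, dif_neg]
            rw [huv]
            exact fun h => hv (key.1 h).2
        · rw [dif_neg hu, zero_mul, dif_neg]
          rw [huv]
          exact fun h => hu (key.1 h).1 }

/-- The set `H_{Λ ∩ θ^⊥}` of the arcs on the orbit closure `Z^{Λ ∩ θ^⊥}` with origin at `0`,
seen as arcs on `Z^Λ` through the embedding of `Z^{Λ ∩ θ^⊥}` in `Z^Λ`. -/
def orbitClosureArcs (Λ : AddSubmonoid E) (θ : Set (StrongDual ℝ E)) (hθ : θ ⊆ sigma Λ) :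
    Set (Arc Λ) :=
  (fun g : Arc (orthSemigroup Λ θ) => AlgHom.comp g (orbitClosureHom Λ θ hθ)) ''
    arcsAtOrigin (orthSemigroup Λ θ)

end Arcs

end

end ToricArcs

/-! Both conditions say that no nonzero `μ` in `σ` vanishes on all exponents of `ν`-weight at most
`s`. For (i): an arc through the orbit closure of `θ` has zero coordinates outside `θ^⊥`, so sharing
an `s`-jet with an arc of the orbit forces weight `> s` there; conversely, killing coordinates of
weight `> s` does not change the `s`-jet (`jet_orbit_inter_nonempty_iff`). For (ii): let `T` be an
independent `k`-set of generators of minimal weight. A greedy exchange shows that `φ_k(ν) ≤ s`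
bounds every weight in `T` by `s` (`apply_le_of_phi_le`), while `s < φ_{k+1}(ν)` makes `T` span all
generators of weight at most `s` (`mem_span_of_lt_phi`), hence all exponents of such weight
(`mem_of_apply_le`). A `μ` in `σ` is nonnegative on generators, so it kills `∑_T e_i` iff it kills
`T`; and a point of `σ^∨` is interior iff no nonzero `μ` in `σ` kills it. -/

namespace ToricArcs

open scoped Pointwise

/-! ### Interior points of the dual cones. -/

section Cones

variable {E : Type*} [NormedAddCommGroup E] [NormedSpace ℝ E]

theorem subset_sigmaDual (Λ : AddSubmonoid E) : (Λ : Set E) ⊆ sigmaDual Λ :=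
  PointedCone.subset_hull

theorem span_eq_top_of_closure_eq_lattice {M : Submodule ℤ E} [DiscreteTopology M] [IsZLattice ℝ M]
    {Λ : AddSubmonoid E} (hM : AddSubgroup.closure (Λ : Set E) = M.toAddSubgroup) :
    Submodule.span ℝ (Λ : Set E) = ⊤ := by
  rw [eq_top_iff, ← IsZLattice.span_top (K := ℝ) (L := M), Submodule.span_le]
  intro x hx
  have hx' : x ∈ AddSubgroup.closure (Λ : Set E) := by rw [hM]; exact hx
  have hle : AddSubgroup.closure (Λ : Set E) ≤ (Submodule.span ℝ (Λ : Set E)).toAddSubgroup :=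
    (AddSubgroup.closure_le _).2 Submodule.subset_span
  exact hle hx'

theorem interior_sigmaDual_nonempty [FiniteDimensional ℝ E] {Λ : AddSubmonoid E}
    (hspan : Submodule.span ℝ (Λ : Set E) = ⊤) :
    (interior (sigmaDual Λ : Set E)).Nonempty := by
  rw [(sigmaDual Λ).convex.interior_nonempty_iff_affineSpan_eq_top,
    AffineSubspace.affineSpan_eq_top_iff_vectorSpan_eq_top_of_nonempty ℝ E E
      ⟨0, (sigmaDual Λ).zero_mem⟩,
    vectorSpan_eq_span_vsub_set_right ℝ (p := (0 : E)) (sigmaDual Λ).zero_mem, eq_top_iff, ← hspan]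
  refine Submodule.span_mono fun x hx => ⟨x, subset_sigmaDual Λ hx, by simp⟩

/-- A point of `σ^∨` that is not interior lies on a proper face of `σ^∨`. -/
theorem exists_mem_sigma_apply_eq_zero {Λ : AddSubmonoid E}
    (hint : (interior (sigmaDual Λ : Set E)).Nonempty) {w : E} (hw : w ∈ sigmaDual Λ)
    (hw' : w ∉ interior (sigmaDual Λ : Set E)) : ∃ μ ∈ sigma Λ, μ ≠ 0 ∧ μ w = 0 := by
  obtain ⟨f, hf⟩ := geometric_hahn_banach_open_point (sigmaDual Λ).convex.interior
    isOpen_interior hw'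
  have hle : ∀ a ∈ sigmaDual Λ, f a ≤ f w := by
    intro a ha
    -- Separation only controls the interior; density of the interior extends the bound to the whole
    -- cone.
    have hcl : a ∈ closure (interior (sigmaDual Λ : Set E)) := by
      rw [(sigmaDual Λ).convex.closure_interior_eq_closure_of_nonempty_interior hint]
      exact subset_closure ha
    exact closure_minimal (fun x hx => (hf x hx).le)
      (isClosed_le f.continuous continuous_const) hcl
  have hnonpos : ∀ a ∈ sigmaDual Λ, f a ≤ 0 := by
    intro a ha
    -- A functional bounded above on a cone is nonpositive there: a positive value could be scaled
    -- past `f w`.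
    by_contra! hpos
    obtain ⟨m, hm⟩ := exists_nat_gt (f w / f a)
    have h1 := hle _ ((sigmaDual Λ).smul_mem (Nat.cast_nonneg (α := ℝ) m) ha)
    rw [map_smul, smul_eq_mul] at h1
    rw [div_lt_iff₀ hpos] at hm
    linarith
  have h0 : f w = 0 := le_antisymm (hnonpos w hw) (by simpa using hle 0 (sigmaDual Λ).zero_mem)
  refine ⟨-f, fun a ha => by simpa using hnonpos a ha, ?_, by simp [h0]⟩
  rintro hf0
  obtain ⟨a, ha⟩ := hint
  have := hf a ha
  rw [neg_eq_zero.1 hf0] at this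
  simp at this

/-- A point near which `f` is nonnegative and where `f` vanishes forces `f = 0`. -/
theorem pos_of_mem_interior_of_nonneg {V : Type*} [NormedAddCommGroup V] [NormedSpace ℝ V]
    {C : Set V} {f : StrongDual ℝ V} (hf : ∀ x ∈ C, 0 ≤ f x) (hf0 : f ≠ 0) {w : V}
    (hw : w ∈ interior C) : 0 < f w := by
  refine (hf w (interior_subset hw)).lt_of_ne fun h0 => hf0 ?_
  ext v
  have hmin : IsLocalMin f w := by
    filter_upwards [mem_interior_iff_mem_nhds.1 hw] with x hx
    rw [← h0]
    exact hf x hx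
  have := hmin.fderiv_eq_zero
  rw [f.fderiv] at this
  simp [this]

theorem pos_of_mem_interior_sigma {Λ : AddSubmonoid E} {ν : StrongDual ℝ E}
    (hν : ν ∈ interior (sigma Λ)) {u : E} (hu : u ∈ sigmaDual Λ) (hu0 : u ≠ 0) : 0 < ν u := by
  refine pos_of_mem_interior_of_nonneg (f := ContinuousLinearMap.apply ℝ ℝ u)
    (C := sigma Λ) (fun _ hμ => hμ u hu) (fun h => hu0 ?_) hν
  -- A norming functional of `u` shows that evaluation at `u` is not zero.
  obtain ⟨g, -, hg⟩ := exists_dual_vector'' ℝ u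
  have := DFunLike.congr_fun h g
  simp only [ContinuousLinearMap.apply_apply, zero_apply] at this
  rw [this] at hg
  exact norm_eq_zero.1 (by simpa using hg.symm)

theorem add_mem_interior_sigmaDual {Λ : AddSubmonoid E} {a c : E}
    (ha : a ∈ interior (sigmaDual Λ : Set E)) (hc : c ∈ sigmaDual Λ) :
    a + c ∈ interior (sigmaDual Λ : Set E) := by
  have hsub : (fun x => x + c) '' interior (sigmaDual Λ : Set E) ⊆ sigmaDual Λ := by
    rintro _ ⟨x, hx, rfl⟩
    exact (sigmaDual Λ).add_mem (interior_subset hx) hc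
  exact interior_maximal hsub ((isOpenMap_add_right c) _ isOpen_interior) ⟨a, ha, rfl⟩

end Cones

/-! ### Support functions and faces of Newton polyhedra. -/

section Newton

variable {E : Type*} [NormedAddCommGroup E] [NormedSpace ℝ E] {Λ : AddSubmonoid E}
  {ν : StrongDual ℝ E} {I : Set E}

theorem mem_newtonPolyhedron {j : E} (hj : j ∈ I) : j ∈ newtonPolyhedron Λ I :=
  subset_convexHull ℝ _ ⟨j, hj, 0, (sigmaDual Λ).zero_mem, add_zero j⟩

theorem le_apply_of_mem_newtonPolyhedron (hν : ν ∈ sigma Λ) {c : ℝ} (hc : ∀ j ∈ I, c ≤ ν j) {w : E}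
    (hw : w ∈ newtonPolyhedron Λ I) : c ≤ ν w := by
  refine convexHull_min (t := {w | c ≤ ν w}) ?_
    (convex_halfSpace_ge ν.toLinearMap.isLinear c) hw
  rintro _ ⟨j, hj, d, hd, rfl⟩
  have h1 := hc j hj
  have h2 := hν d hd
  simp only [Set.mem_ofPred_eq, map_add]
  linarith

theorem ordFun_le (hν : ν ∈ sigma Λ) (hI : I ⊆ sigmaDual Λ) {w : E}
    (hw : w ∈ newtonPolyhedron Λ I) : ordFun Λ I ν ≤ ν w := by
  refine csInf_le ⟨0, ?_⟩ ⟨w, hw, rfl⟩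
  rintro _ ⟨x, hx, rfl⟩
  exact le_apply_of_mem_newtonPolyhedron hν (fun j hj => hν j (hI hj)) hx

theorem exists_apply_eq_ordFun (hν : ν ∈ sigma Λ) (hI : I ⊆ sigmaDual Λ) (hfin : I.Finite)
    (hne : I.Nonempty) : ∃ j ∈ I, ν j = ordFun Λ I ν := by
  obtain ⟨j, hj, hmin⟩ := hfin.exists_minimalFor ν I hne
  refine ⟨j, hj, le_antisymm ?_ (ordFun_le hν hI (mem_newtonPolyhedron hj))⟩
  refine le_csInf ⟨_, j, mem_newtonPolyhedron hj, rfl⟩ ?_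
  rintro _ ⟨x, hx, rfl⟩
  refine le_apply_of_mem_newtonPolyhedron hν (fun i hi => ?_) hx
  rcases le_total (ν j) (ν i) with h | h
  · exact h
  · exact hmin hi h

/-- The face of `𝒩(I)` determined by `ν` is interior to `σ^∨` as soon as the points of `I` on it
are. -/
theorem newtonFace_subset_interior_iff (hν : ν ∈ sigma Λ) (hI : I ⊆ sigmaDual Λ) :
    newtonFace Λ I ν ⊆ interior (sigmaDual Λ : Set E) ↔
      ∀ j ∈ I, ν j = ordFun Λ I ν → j ∈ interior (sigmaDual Λ : Set E) := by
  refine ⟨fun h j hj hνj => h ⟨mem_newtonPolyhedron hj, hνj⟩, fun h => ?_⟩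
  rintro w ⟨hw, hνw⟩
  -- This set is convex: if a combination with positive coefficients attains the minimum, both
  -- endpoints do.
  have key : newtonPolyhedron Λ I ⊆ {w | ordFun Λ I ν ≤ ν w ∧
      (ν w = ordFun Λ I ν → w ∈ interior (sigmaDual Λ : Set E))} := by
    refine convexHull_min ?_ ?_
    · rintro _ ⟨j, hj, d, hd, rfl⟩
      have h1 := ordFun_le hν hI (mem_newtonPolyhedron hj)
      have h2 := hν d hd
      simp only [Set.mem_ofPred_eq, map_add]
      refine ⟨by linarith, fun h3 => add_mem_interior_sigmaDual (h j hj (by linarith)) hd⟩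
    · rw [convex_iff_forall_pos]
      rintro x ⟨hx, hx'⟩ y ⟨hy, hy'⟩ a b ha hb hab
      have hb' : b = 1 - a := by linarith
      simp only [Set.mem_ofPred_eq, map_add, map_smul, smul_eq_mul]
      have h1 := mul_le_mul_of_nonneg_left hx ha.le
      have h2 := mul_le_mul_of_nonneg_left hy hb.le
      have h3 : a * ordFun Λ I ν + b * ordFun Λ I ν = ordFun Λ I ν := by
        rw [← add_mul, hab, one_mul]
      refine ⟨by linarith, fun h4 => ?_⟩
      have h5 : a * ν x = a * ordFun Λ I ν := by linarith
      have h6 : b * ν y = b * ordFun Λ I ν := by linarith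
      exact (sigmaDual Λ).convex.interior (hx' (mul_left_cancel₀ ha.ne' h5))
        (hy' (mul_left_cancel₀ hb.ne' h6)) ha.le hb.le hab
  exact (key hw).2 hνw

end Newton

/-! ### Independent sets of generators of minimal weight. -/

section Greedy

variable {E : Type*} [NormedAddCommGroup E] [NormedSpace ℝ E] {n : ℕ} {e : Fin n → E}

theorem ιMulti_ne_zero_iff {k : ℕ} {v : Fin k → E} :
    ExteriorAlgebra.ιMulti ℝ k v ≠ 0 ↔ LinearIndependent ℝ v := by
  refine ⟨fun h => ?_, fun hv h0 => ?_⟩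
  · by_contra hv
    exact h (AlternatingMap.map_linearDependent _ v hv)
  · have h1 := (exteriorPower.ιMulti_family_linearIndependent_field k hv).ne_zero
      (Set.powersetCard.ofFinEmbEquiv (RelEmbedding.refl _))
    apply h1
    ext
    simpa [ExteriorAlgebra.ιMulti_family, Function.comp_def] using h0

/-- Finite subsets replace increasing tuples so that the exchange arguments can erase or insert one
generator. -/
theorem mem_logJacobian_iff {k : ℕ} {w : E} :
    w ∈ logJacobian e k ↔
      ∃ T : Finset (Fin n), T.card = k ∧ LinearIndepOn ℝ e (T : Set (Fin n)) ∧
        w = ∑ i ∈ T, e i := by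
  constructor
  · rintro ⟨i, hi, hne, rfl⟩
    rw [ιMulti_ne_zero_iff] at hne
    refine ⟨Finset.univ.map ⟨i, hi.injective⟩, by simp, ?_, by simp⟩
    have := (linearIndepOn_range_iff hi.injective e).2 hne
    simpa using this
  · rintro ⟨T, hT, hli, rfl⟩
    refine ⟨T.orderEmbOfFin hT, (T.orderEmbOfFin hT).strictMono, ?_, ?_⟩
    · rw [ιMulti_ne_zero_iff]
      apply (linearIndepOn_range_iff (T.orderEmbOfFin hT).injective e).1
      rwa [Finset.range_orderEmbOfFin]
    · conv_lhs => rw [← Finset.map_orderEmbOfFin_univ T hT, Finset.sum_map]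
      rfl

theorem logJacobian_finite (k : ℕ) : (logJacobian e k).Finite := by
  refine (Set.finite_range fun T : Finset (Fin n) => ∑ i ∈ T, e i).subset fun w hw => ?_
  obtain ⟨T, -, -, rfl⟩ := mem_logJacobian_iff.1 hw
  exact ⟨T, rfl⟩

theorem logJacobian_nonempty (hspan : Submodule.span ℝ (Set.range e) = ⊤) {k : ℕ}
    (hk : k ≤ Module.finrank ℝ E) : (logJacobian e k).Nonempty := by
  classical
  obtain ⟨S, -, -, hS, hli⟩ := exists_linearIndepOn_extension (K := ℝ) (v := e)
    (linearIndepOn_empty ℝ e) (Set.empty_subset Set.univ)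
  have hcard : S.toFinset.card = Module.finrank ℝ E := by
    have htop : Submodule.span ℝ (e '' S) = ⊤ := by
      rw [eq_top_iff, ← hspan, Submodule.span_le, ← Set.image_univ]
      exact hS
    rw [← finrank_top ℝ E, ← htop, Set.image_eq_range, finrank_span_eq_card hli, Set.toFinset_card]
  obtain ⟨T, hT, hTk⟩ := Finset.exists_subset_card_eq (hcard ▸ hk)
  refine ⟨_, mem_logJacobian_iff.2 ⟨T, hTk, hli.mono fun i hi => ?_, rfl⟩⟩
  simpa using hT hi

theorem logJacobian_subset_sigmaDual {Λ : AddSubmonoid E} (he : ∀ i, e i ∈ Λ) (k : ℕ) :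
    logJacobian e k ⊆ sigmaDual Λ := by
  intro w hw
  obtain ⟨T, -, -, rfl⟩ := mem_logJacobian_iff.1 hw
  exact (sigmaDual Λ).sum_mem fun i _ => subset_sigmaDual Λ (he i)

theorem ordFun_logJacobian_le {Λ : AddSubmonoid E} {ν : StrongDual ℝ E} (hν : ν ∈ sigma Λ)
    (he : ∀ i, e i ∈ Λ) {T : Finset (Fin n)} (hT : LinearIndepOn ℝ e (T : Set (Fin n))) :
    ordFun Λ (logJacobian e T.card) ν ≤ ∑ i ∈ T, ν (e i) := by
  rw [← map_sum]
  exact ordFun_le hν (logJacobian_subset_sigmaDual he _)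
    (mem_newtonPolyhedron (mem_logJacobian_iff.2 ⟨T, rfl, hT, rfl⟩))

/-- The only competitor is the empty sum. This makes `φ_1` an instance of the difference formula in
`phi_succ`. -/
theorem ordFun_logJacobian_zero {Λ : AddSubmonoid E} {ν : StrongDual ℝ E} (hν : ν ∈ sigma Λ)
    (he : ∀ i, e i ∈ Λ) : ordFun Λ (logJacobian e 0) ν = 0 := by
  obtain ⟨j, hj, h⟩ := exists_apply_eq_ordFun hν (logJacobian_subset_sigmaDual he 0)
    (logJacobian_finite 0) ⟨0, mem_logJacobian_iff.2 ⟨∅, by simp⟩⟩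
  obtain ⟨T, hT, -, rfl⟩ := mem_logJacobian_iff.1 hj
  rw [Finset.card_eq_zero] at hT
  rw [← h, hT, Finset.sum_empty, map_zero]

theorem phi_succ {Λ : AddSubmonoid E} {ν : StrongDual ℝ E} (hν : ν ∈ sigma Λ)
    (he : ∀ i, e i ∈ Λ) {k : ℕ} (hk : k + 1 ≤ Module.finrank ℝ E) :
    phi Λ e (k + 1) ν =
      ((ordFun Λ (logJacobian e (k + 1)) ν - ordFun Λ (logJacobian e k) ν : ℝ) : EReal) := by
  rw [phi, if_neg (Nat.succ_ne_zero k), if_neg hk.not_gt]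
  rcases Nat.eq_zero_or_pos k with rfl | hk0
  · rw [if_pos rfl, ordFun_logJacobian_zero hν he, sub_zero]
  · rw [if_neg (by omega), Nat.add_sub_cancel]

/-- If `φ_k(ν) ≤ s` then the generators in a `k`-element set of minimal weight have weight at most
`s`. -/
theorem apply_le_of_phi_le {Λ : AddSubmonoid E} {ν : StrongDual ℝ E} (hν : ν ∈ sigma Λ)
    (he : ∀ i, e i ∈ Λ) {s : ℝ} {T : Finset (Fin n)} (hT : LinearIndepOn ℝ e (T : Set (Fin n)))
    (hmin : ∑ i ∈ T, ν (e i) = ordFun Λ (logJacobian e T.card) ν)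
    (hTd : T.card ≤ Module.finrank ℝ E) (hs : phi Λ e T.card ν ≤ (s : EReal))
    {i : Fin n} (hi : i ∈ T) : ν (e i) ≤ s := by
  obtain ⟨k, hk⟩ := Nat.exists_eq_succ_of_ne_zero (Finset.card_ne_zero_of_mem hi)
  have hk' : (T.erase i).card = k := by rw [Finset.card_erase_of_mem hi, hk]; rfl
  -- `T \ {i}` competes for `ord_{𝒥_{k-1}}`, so the weight of `e i` is at most `φ_k(ν)`.
  have h1 := ordFun_logJacobian_le hν he
    (T := T.erase i) (hT.mono (by simp))
  rw [hk, Nat.succ_eq_add_one, phi_succ hν he (by omega), EReal.coe_le_coe_iff] at hs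
  rw [hk] at hmin
  rw [hk'] at h1
  have h2 := Finset.add_sum_erase T (fun i => ν (e i)) hi
  simp only [Nat.succ_eq_add_one] at *
  linarith

/-- If `s < φ_{k+1}(ν)` then the generators in a `k`-element set of minimal weight span those of
weight at most `s`. -/
theorem mem_span_of_lt_phi [FiniteDimensional ℝ E] {Λ : AddSubmonoid E} {ν : StrongDual ℝ E}
    (hν : ν ∈ sigma Λ) (he : ∀ i, e i ∈ Λ) {s : ℝ} {T : Finset (Fin n)}
    (hT : LinearIndepOn ℝ e (T : Set (Fin n)))
    (hmin : ∑ i ∈ T, ν (e i) = ordFun Λ (logJacobian e T.card) ν)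
    (hs : (s : EReal) < phi Λ e (T.card + 1) ν) {i : Fin n} (hi : ν (e i) ≤ s) :
    e i ∈ Submodule.span ℝ (e '' T) := by
  classical
  by_contra hni
  have hiT : i ∉ T := fun h => hni (Submodule.subset_span ⟨i, h, rfl⟩)
  have hli : LinearIndepOn ℝ e ((insert i T : Finset (Fin n)) : Set (Fin n)) := by
    rw [Finset.coe_insert]
    exact hT.insert hni
  have hcard := Finset.card_insert_of_notMem hiT
  -- The enlarged independent set rules out the case `φ_{k+1} = ⊤`.
  have hd : T.card + 1 ≤ Module.finrank ℝ E := by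
    rw [← hcard]
    simpa using hli.fintype_card_le_finrank
  have h1 := ordFun_logJacobian_le hν he hli
  rw [hcard, Finset.sum_insert hiT] at h1
  rw [phi_succ hν he hd, EReal.coe_lt_coe_iff] at hs
  linarith

end Greedy

/-! ### Arcs and jets through their monomial coordinates. -/

section Coordinates

variable {E : Type*} [NormedAddCommGroup E] {Λ : AddSubmonoid E}

theorem coord_zero (h : Arc Λ) : coord h 0 = 1 := map_one h

theorem coord_add (h : Arc Λ) (u v : Λ) : coord h (u + v) = coord h u * coord h v := by
  rw [coord, coord, coord, ← map_mul, AddMonoidAlgebra.single_mul_single, one_mul]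

theorem exists_arc_coord_eq (f : Multiplicative Λ →* PowerSeries ℂ) :
    ∃ h : Arc Λ, ∀ u, coord h u = f (Multiplicative.ofAdd u) :=
  ⟨AddMonoidAlgebra.lift ℂ _ _ f, fun u => by simp [coord]⟩

theorem jet_eq_jet_iff {s : ℕ} {h h' : Arc Λ} :
    jet s h = jet s h' ↔
      ∀ u, (PowerSeries.X : PowerSeries ℂ) ^ (s + 1) ∣ coord h u - coord h' u := by
  have hu : ∀ u, (PowerSeries.X : PowerSeries ℂ) ^ (s + 1) ∣ coord h u - coord h' u ↔
      jet s h (AddMonoidAlgebra.single u 1) = jet s h' (AddMonoidAlgebra.single u 1) := by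
    intro u
    rw [← Ideal.mem_span_singleton, ← Ideal.Quotient.eq]
    rfl
  simp only [hu]
  refine ⟨fun h u => by rw [h], fun h => ?_⟩
  exact AddMonoidAlgebra.algHom_ext h (Subsingleton.elim _ _)

end Coordinates

/-! ### Jets of torus orbits and of orbit closures. -/

section Arcs

variable {E : Type*} [NormedAddCommGroup E] [NormedSpace ℝ E] {Λ : AddSubmonoid E}

theorem X_pow_dvd_coord_iff {ν : StrongDual ℝ E} {h : Arc Λ} (hh : h ∈ orbit Λ ν) (s : ℕ) (u : Λ) :
    (PowerSeries.X : PowerSeries ℂ) ^ (s + 1) ∣ coord h u ↔ (s : ℝ) < ν u := by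
  -- Nonvanishing excludes order `⊤`, which `toNat` would turn into `0`.
  have h0 : coord h u ≠ 0 := hh.1.2 u
  rw [← hh.2 u, Nat.cast_lt, PowerSeries.X_pow_dvd_iff]
  constructor
  · intro H
    by_contra! hle
    exact PowerSeries.coeff_order h0 (H _ (by omega))
  · intro H m hm
    exact PowerSeries.coeff_of_lt_order_toNat m (by omega)

theorem coord_comp_orbitClosureHom_of_mem {θ : Set (StrongDual ℝ E)} (hθ : θ ⊆ sigma Λ)
    (g : Arc (orthSemigroup Λ θ)) {u : Λ} (hu : (u : E) ∈ orthSemigroup Λ θ) :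
    coord (g.comp (orbitClosureHom Λ θ hθ)) u = coord g ⟨u, hu⟩ := by
  simp [coord, orbitClosureHom, hu]

theorem coord_comp_orbitClosureHom_of_notMem {θ : Set (StrongDual ℝ E)} (hθ : θ ⊆ sigma Λ)
    (g : Arc (orthSemigroup Λ θ)) {u : Λ} (hu : (u : E) ∉ orthSemigroup Λ θ) :
    coord (g.comp (orbitClosureHom Λ θ hθ)) u = 0 := by
  simp [coord, orbitClosureHom, hu]

/-- The monomial arc `X^u ↦ t^{⟨ν, u⟩}`. -/
theorem orbit_nonempty {ν : StrongDual ℝ E} (hν : ν ∈ interior (sigma Λ))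
    (hint : ∀ u ∈ Λ, ∃ z : ℤ, ν u = z) : (orbit Λ ν).Nonempty := by
  have hnat : ∀ u : Λ, ∃ m : ℕ, ν (u : E) = m := by
    intro u
    obtain ⟨z, hz⟩ := hint u u.2
    have h0 : 0 ≤ ν (u : E) := interior_subset hν u (subset_sigmaDual Λ u.2)
    lift z to ℕ using (by rw [hz] at h0; exact_mod_cast h0)
    exact ⟨z, by simpa using hz⟩
  choose m hm using hnat
  have hm0 : m 0 = 0 := by
    have := hm 0
    simpa using this.symm
  have hadd : ∀ u v, m (u + v) = m u + m v := by
    intro u v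
    have := hm (u + v)
    rw [AddSubmonoid.coe_add, map_add, hm, hm] at this
    exact_mod_cast this.symm
  obtain ⟨h, hh⟩ := exists_arc_coord_eq (Λ := Λ)
    { toFun := fun u => (PowerSeries.X : PowerSeries ℂ) ^ m u.toAdd
      map_one' := by simp [hm0]
      map_mul' := fun u v => by simp [hadd, pow_add] }
  replace hh : ∀ u, coord h u = (PowerSeries.X : PowerSeries ℂ) ^ m u := hh
  refine ⟨h, ⟨fun u hu => ?_, fun u => ?_⟩, fun u => ?_⟩
  · have hpos : 0 < ν (u : E) :=
      pos_of_mem_interior_sigma hν (subset_sigmaDual Λ u.2) (by simpa using hu)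
    rw [hm] at hpos
    have : m u ≠ 0 := (Nat.cast_pos.1 hpos).ne'
    rw [hh, map_pow, PowerSeries.constantCoeff_X, zero_pow this]
  · rw [hh]
    exact pow_ne_zero _ PowerSeries.X_ne_zero
  · rw [hh, PowerSeries.order_X_pow, hm]
    rfl

/-- The `s`-jets of the orbit of `ν` meet those of the orbit closure of `θ` exactly when all the
exponents of weight at most `s` are orthogonal to `θ`. -/
theorem jet_orbit_inter_nonempty_iff {ν : StrongDual ℝ E} (hν : ν ∈ interior (sigma Λ))
    (hint : ∀ u ∈ Λ, ∃ z : ℤ, ν u = z) {θ : Set (StrongDual ℝ E)} (hθ : θ ⊆ sigma Λ) (s : ℕ) :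
    (jet s '' orbit Λ ν ∩ jet s '' orbitClosureArcs Λ θ hθ).Nonempty ↔
      ∀ u ∈ Λ, ν u ≤ s → ∀ μ ∈ θ, μ u = 0 := by
  constructor
  · rintro ⟨_, ⟨h, hh, rfl⟩, _, ⟨g, -, rfl⟩, hg⟩ u hu hus
    by_contra! hμ
    have hnot : u ∉ orthSemigroup Λ θ := by
      rintro ⟨-, h0⟩
      obtain ⟨μ, hμθ, hμ0⟩ := hμ
      exact hμ0 (h0 μ hμθ)
    have h1 := jet_eq_jet_iff.1 hg.symm ⟨u, hu⟩
    rw [coord_comp_orbitClosureHom_of_notMem hθ g (u := ⟨u, hu⟩) hnot, sub_zero,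
      X_pow_dvd_coord_iff hh] at h1
    exact h1.not_ge hus
  · intro H
    obtain ⟨h, hh⟩ := orbit_nonempty hν hint
    -- The arc on the orbit closure keeps the coordinates of `h` in `θ^⊥`; by `H` the discarded ones
    -- have order `> s`.
    obtain ⟨g, hg⟩ := exists_arc_coord_eq (Λ := orthSemigroup Λ θ)
      { toFun := fun u => coord h ⟨u.toAdd, u.toAdd.2.1⟩
        map_one' := coord_zero h
        map_mul' := fun u v => coord_add h ⟨u.toAdd, u.toAdd.2.1⟩ ⟨v.toAdd, v.toAdd.2.1⟩ }
    replace hg : ∀ u, coord g u = coord h ⟨u, u.2.1⟩ := hg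
    refine ⟨jet s h, ⟨h, hh, rfl⟩, _, ⟨g, fun u hu => ?_, rfl⟩, ?_⟩
    · rw [hg]
      refine hh.1.1 _ fun h0 => hu (Subtype.ext ?_)
      exact congrArg (fun x : Λ => (x : E)) h0
    · refine (jet_eq_jet_iff.2 fun u => ?_).symm
      by_cases hu : (u : E) ∈ orthSemigroup Λ θ
      · rw [coord_comp_orbitClosureHom_of_mem hθ g hu, hg, sub_self]
        exact dvd_zero _
      · rw [coord_comp_orbitClosureHom_of_notMem hθ g hu, sub_zero, X_pow_dvd_coord_iff hh]
        by_contra! hle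
        exact hu ⟨u.2, H u u.2 hle⟩

end Arcs

/-- If `V` contains the generators of weight at most `s`, then it contains all the exponents of
weight at most `s`. -/
theorem mem_of_apply_le {E : Type*} [NormedAddCommGroup E] [NormedSpace ℝ E] {S : Set E}
    {ν : StrongDual ℝ E} (hν : ∀ u ∈ AddSubmonoid.closure S, 0 ≤ ν u) {s : ℝ} {V : AddSubmonoid E}
    (hV : ∀ x ∈ S, ν x ≤ s → x ∈ V) {u : E} (hu : u ∈ AddSubmonoid.closure S) (hus : ν u ≤ s) :
    u ∈ V := by
  induction hu using AddSubmonoid.closure_induction with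
  | mem x hx => exact hV x hx hus
  | zero => exact V.zero_mem
  | add x y hx hy ihx ihy =>
    have h1 := hν x hx
    have h2 := hν y hy
    rw [map_add] at hus
    exact V.add_mem (ihx (by linarith)) (ihy (by linarith))

end ToricArcs

theorem proposition8p7
    {E : Type*} [NormedAddCommGroup E] [NormedSpace ℝ E] [FiniteDimensional ℝ E]
    (M : Submodule ℤ E) [DiscreteTopology M] [IsZLattice ℝ M]
    (Λ : AddSubmonoid E)
    (hM : AddSubgroup.closure (Λ : Set E) = M.toAddSubgroup)
    (hconvex : (ToricArcs.sigmaDual Λ).toConvexCone.Salient)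
    {n : ℕ} (e : Fin n → E) (he : ToricArcs.IsMinimalGenerators Λ e)
    (k : ℕ) (hk : 1 ≤ k) (hkd : k ≤ Module.finrank ℝ E)
    (ν : StrongDual ℝ E) (s : ℕ) (hνs : (ν, s) ∈ ToricArcs.setA M Λ e k) :
    (ToricArcs.jet s '' ToricArcs.orbit Λ ν) ∩
        (⋃ (θ : Set (StrongDual ℝ E)) (hθ : ToricArcs.IsFace Λ θ) (_ : θ ≠ {0}),
          ToricArcs.jet s '' ToricArcs.orbitClosureArcs Λ θ hθ.subset_sigma) = ∅ ↔
      ToricArcs.newtonFace Λ (ToricArcs.logJacobian e k) ν ⊆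
        interior (ToricArcs.sigmaDual Λ : Set E) := by
  open ToricArcs in
  obtain ⟨hνint, hνN, hs, hs'⟩ := hνs
  have hν : ν ∈ sigma Λ := interior_subset hνint
  have heΛ : ∀ i, e i ∈ Λ := fun i => he.2.1 ▸ AddSubmonoid.subset_closure ⟨i, rfl⟩
  have hνZ : ∀ u ∈ Λ, ∃ z : ℤ, ν u = z := fun u hu => hνN u <| by
    have : u ∈ M.toAddSubgroup := hM ▸ AddSubgroup.subset_closure hu
    exact this
  have hΛ := span_eq_top_of_closure_eq_lattice hM
  have hespan : Submodule.span ℝ (Set.range e) = ⊤ := by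
    rw [eq_top_iff, ← hΛ, Submodule.span_le, ← he.2.1]
    exact (AddSubmonoid.closure_le (S := (Submodule.span ℝ (Set.range e)).toAddSubmonoid)).2
      Submodule.subset_span
  have hJ := logJacobian_subset_sigmaDual heΛ k
  rw [newtonFace_subset_interior_iff hν hJ]
  have hleft : (jet s '' orbit Λ ν) ∩
        (⋃ (θ : Set (StrongDual ℝ E)) (hθ : IsFace Λ θ) (_ : θ ≠ {0}),
          jet s '' orbitClosureArcs Λ θ hθ.subset_sigma) = ∅ ↔
      ∀ θ, IsFace Λ θ → θ ≠ {0} → ¬ ∀ u ∈ Λ, ν u ≤ s → ∀ μ ∈ θ, μ u = 0 := by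
    simp only [Set.inter_iUnion, Set.iUnion_eq_empty]
    refine forall_congr' fun θ => forall_congr' fun hθ => forall_congr' fun _ => ?_
    rw [← jet_orbit_inter_nonempty_iff hνint hνZ hθ.subset_sigma, Set.not_nonempty_iff_eq_empty]
  rw [hleft]
  constructor
  · intro H j hj hjmin
    by_contra hjint
    obtain ⟨μ, hμ, hμ0, hμj⟩ :=
      exists_mem_sigma_apply_eq_zero (interior_sigmaDual_nonempty hΛ) (hJ hj) hjint
    -- The witness is the face of `σ` cut out by the non-interior point `j` itself.
    refine H {μ ∈ sigma Λ | μ j = 0} ⟨j, hJ hj, rfl⟩ (fun h0 => hμ0 ?_) ?_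
    · have : μ ∈ ({0} : Set (StrongDual ℝ E)) := h0 ▸ ⟨hμ, hμj⟩
      exact this
    · rintro u hu hus μ' ⟨hμ', hμ'j⟩
      obtain ⟨T, rfl, hT, rfl⟩ := mem_logJacobian_iff.1 hj
      rw [map_sum] at hjmin hμ'j
      rw [Finset.sum_eq_zero_iff_of_nonneg
        (fun i _ => hμ' _ (subset_sigmaDual Λ (heΛ i)))] at hμ'j
      have hker : Submodule.span ℝ (e '' T) ≤ LinearMap.ker μ'.toLinearMap := by
        rw [Submodule.span_le]
        rintro _ ⟨i, hi, rfl⟩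
        exact hμ'j i hi
      rw [← he.2.1] at hu
      refine mem_of_apply_le (ν := ν) (s := s) (V := (LinearMap.ker μ'.toLinearMap).toAddSubmonoid)
        (fun v hv => hν v (subset_sigmaDual Λ (he.2.1 ▸ hv))) ?_ hu hus
      rintro _ ⟨i, rfl⟩ hi
      exact hker (mem_span_of_lt_phi hν heΛ hT hjmin hs' hi)
  · rintro H θ ⟨w, hw, rfl⟩ hθ0 hall
    obtain ⟨j, hj, hjmin⟩ := exists_apply_eq_ordFun hν hJ (logJacobian_finite k)
      (logJacobian_nonempty hespan hkd)
    have hjint := H j hj hjmin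
    obtain ⟨μ, hμθ, hμ0⟩ : ∃ μ ∈ {μ ∈ sigma Λ | μ w = 0}, μ ≠ 0 := by
      by_contra! hz
      exact hθ0 (Set.eq_singleton_iff_unique_mem.2 ⟨⟨fun _ _ => le_rfl, rfl⟩, hz⟩)
    -- `μ` is positive at the interior point `j`, yet vanishes on every generator in `T`, as these
    -- have weight at most `s`.
    refine (pos_of_mem_interior_of_nonneg hμθ.1 hμ0 hjint).ne' ?_
    obtain ⟨T, rfl, hT, rfl⟩ := mem_logJacobian_iff.1 hj
    rw [map_sum] at hjmin ⊢
    exact Finset.sum_eq_zero fun i hi =>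
      hall _ (heΛ i) (apply_le_of_phi_le hν heΛ hT hjmin hkd hs hi) μ hμθ
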